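/- Let $n\ge 1$ and let $f$ be a Bernstein function without linear term, i.e. $f(t)=a+\int_{(0,\infty)}(1-e^{-st})\,\mu(ds)$ for $t\ge 0$, where $a\ge 0$ and $\mu$ is a measure on $(0,\infty)$ with $\int_{(0,\infty)}(1\wedge s)\,\mu(ds)<\infty$. Assume that $f$ is not identically zero and that, for some $\kappa\in(0,1)$, the function $t\mapsto f(t)\,t^{-\kappa}$ is increasing (in the wide sense) on $[T,\infty)$ for some $T>0$. Then $f$ is a bijection of $[0,\infty)$ onto $[f(0),\infty)$; let $f^{-1}$ denote its inverse. Let $\psi$ be one of the following two functions on $\mathbb R^n$: either $\psi(\xi)=f(|\xi|^2)$, or $$\psi(\xi)=\psi_1(\xi):=\int_{B(0,1)}\bigl(1-\cos(\xi\cdot y)\bigr)\,f\!\left(\frac1{|y|^2}\right)\frac{dy}{|y|^n},$$ where in the second case it is assumed that this integral is finite for every $\xi\in\mathbb R^n$. Then there are constants $c>0$ and $\gamma\in(0,1]$, depending only on $n$, $f$ and the choice of $\psi$, with $1/(\gamma t)\ge f(0)$ for all $0<t\le 1$, such that the following holds. Every Lévy process $(X_t)_{t\ge0}$ in $\mathbb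 R^n$ with characteristic exponent $\psi$, i.e. $\mathbb E\,e^{i\xi\cdot X_t}=e^{-t\psi(\xi)}$ for all $t\ge0$ and $\xi\in\mathbb R^n$, has a transition density: there are measurable functions $p_t\ge 0$ such that $X_t$ has the law $p_t(x)\,dx$ for every $t>0$. Moreover these functions can be chosen such that $$p_t(x)\le c\left[f^{-1}\!\left(\frac1{\gamma t}\right)\right]^{n/2}\qquad\text{for all } 0<t\le 1\text{ and } x\in\mathbb R^n .$$ -/

import Mathlib

open MeasureTheory ProbabilityTheory Set Filter Topology
open scoped NNReal ENNReal RealInnerProductSpace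

noncomputable section

/-- `f` is, on `[0, ∞)`, the Bernstein function with characteristics `(a, b, μ)`:
`f t = a + b t + ∫_{(0,∞)} (1 - e^{-s t}) μ(ds)`, where `a, b ≥ 0` and `μ` is a measure on `(0, ∞)`
(realised as a measure on `ℝ` that does not charge `(-∞, 0]`) with `∫ (1 ∧ s) μ(ds) < ∞`.
The values of `f` at negative arguments are irrelevant. -/
structure IsBernsteinWith (f : ℝ → ℝ) (a b : ℝ) (μ : Measure ℝ) : Prop where
  killing_nonneg : 0 ≤ a
  drift_nonneg : 0 ≤ b
  concentrated : μ (Iic 0) = 0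
  integrability : ∫⁻ s, ENNReal.ofReal (min 1 s) ∂μ < ∞
  repr : ∀ t : ℝ, 0 ≤ t → f t = a + b * t + ∫ s, (1 - Real.exp (-(s * t))) ∂μ

/-- `f` is a Bernstein function without linear term. -/
def IsBernsteinNoLinear (f : ℝ → ℝ) : Prop :=
  ∃ (a : ℝ) (μ : Measure ℝ), IsBernsteinWith f a 0 μ

/-- The inverse of `f : [0, ∞) → ℝ`; meaningful at the values of `f`, where `f` is injective. -/
def invNonneg (f : ℝ → ℝ) (y : ℝ) : ℝ :=
  Function.invFunOn f (Ici 0) y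

/-- The integrand `(1 - cos (ξ · y)) f(1 / |y|²) |y|^{-n}` defining `ψ₁(ξ)`. -/
def psiOneIntegrand (n : ℕ) (f : ℝ → ℝ) (ξ y : EuclideanSpace ℝ (Fin n)) : ℝ :=
  (1 - Real.cos ⟪ξ, y⟫) * f (1 / ‖y‖ ^ 2) / ‖y‖ ^ n

/-- `ψ₁(ξ) = ∫_{B(0,1)} (1 - cos (ξ · y)) f(1 / |y|²) |y|^{-n} dy`. -/
def psiOne (n : ℕ) (f : ℝ → ℝ) (ξ : EuclideanSpace ℝ (Fin n)) : ℝ :=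
  ∫ y in Metric.ball (0 : EuclideanSpace ℝ (Fin n)) 1, psiOneIntegrand n f ξ y

/-- The integral defining `ψ₁(ξ)` is finite for every `ξ`. -/
def PsiOneFinite (n : ℕ) (f : ℝ → ℝ) : Prop :=
  ∀ ξ : EuclideanSpace ℝ (Fin n),
    IntegrableOn (psiOneIntegrand n f ξ) (Metric.ball (0 : EuclideanSpace ℝ (Fin n)) 1)

/-- An `ℝⁿ`-valued Lévy process: it starts at `0`, has independent and stationary increments and is
stochastically continuous. -/
structure IsLevyProcess {n : ℕ} {Ω : Type*} [MeasurableSpace Ω]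
    (X : ℝ≥0 → Ω → EuclideanSpace ℝ (Fin n)) (P : Measure Ω) : Prop where
  measurable : ∀ t, Measurable (X t)
  start : ∀ᵐ ω ∂P, X 0 ω = 0
  indep : HasIndepIncrements X P
  stationary : ∀ s t, IdentDistrib (X (s + t) - X s) (X t - X 0) P P
  stochCont : ∀ s, TendstoInMeasure P X (𝓝 s) (X s)

/-- The (real) characteristic exponent of `X` is `ψ`: `E e^{i ξ · X_t} = e^{-t ψ(ξ)}`. -/
def HasExponent {n : ℕ} {Ω : Type*} [MeasurableSpace Ω]
    (X : ℝ≥0 → Ω → EuclideanSpace ℝ (Fin n)) (P : Measure Ω)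
    (ψ : EuclideanSpace ℝ (Fin n) → ℝ) : Prop :=
  ∀ (t : ℝ≥0) (ξ : EuclideanSpace ℝ (Fin n)),
    charFun (P.map (X t)) ξ = ((Real.exp (-((t : ℝ) * ψ ξ)) : ℝ) : ℂ)

/-- `p` is a transition density of the Lévy process `X`: for every `t > 0` the law of `X_t` is
`p_t(x) dx`, i.e. the transition probabilities are `P (x + X_t ∈ A) = ∫_A p_t(y - x) dy`. -/
def IsTransitionDensity {n : ℕ} {Ω : Type*} [MeasurableSpace Ω]
    (X : ℝ≥0 → Ω → EuclideanSpace ℝ (Fin n)) (P : Measure Ω)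
    (p : ℝ≥0 → EuclideanSpace ℝ (Fin n) → ℝ) : Prop :=
  ∀ t : ℝ≥0, 0 < t → Measurable (p t) ∧ (∀ x, 0 ≤ p t x) ∧
    P.map (X t) = volume.withDensity (fun x => ENNReal.ofReal (p t x))

end

/-! When $e^{-t\psi}$ is integrable, Fourier inversion bounds the density of $X_t$ by $\int
e^{-t\psi(2\pi\xi)}\,d\xi$ (`exists_density_of_integrable_charFun`). For $|\xi|\ge 1$ one has
$\psi(\xi)\ge c_0 f(|\xi|^2)$, trivially for $f(|\xi|^2)$ and by `exists_mul_le_psiOne` for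
$\psi_1$.

Put $R=f^{-1}(1/(\gamma t))$ with $\gamma$ so small that $R\ge\max(1,T)$ and $\gamma\le c_0$. For
$|\xi|^2\ge R$ the growth hypothesis (`rpow_div_mul_le_of_monotoneOn`) gives
$f(|\xi|^2)\ge(|\xi|^2/R)^\kappa/(\gamma t)$, hence $t\psi(\xi)\ge(|\xi|^2/R)^\kappa$. The range
$|\xi|^2<R$ costs only a factor $e$. Rescaling $\xi$ by $\sqrt R$ then produces $R^{n/2}$ times an
integral depending on $n$ and $\kappa$ alone. -/

/-! ### Fourier inversion for finite measures. -/

section DensityOfCharFun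

open scoped ContDiff FourierTransform SchwartzMap

variable {V : Type*} [NormedAddCommGroup V] [InnerProductSpace ℝ V] [FiniteDimensional ℝ V]
  [MeasurableSpace V] [BorelSpace V]

/-- By inner regularity it suffices to squeeze a smooth bump between the indicators of a compact
$K\subseteq U$ and of $U$. -/
lemma measure_isOpen_le_of_integral_contDiff_le {ν ρ : Measure V}
    [IsLocallyFiniteMeasure ν] [IsLocallyFiniteMeasure ρ]
    (h : ∀ g : V → ℝ, ContDiff ℝ ∞ g → HasCompactSupport g → (∀ x, 0 ≤ g x) →
      ∫ x, g x ∂ν ≤ ∫ x, g x ∂ρ) {U : Set V} (hU : IsOpen U) : ν U ≤ ρ U := by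
  rw [hU.measure_eq_iSup_isCompact]
  refine iSup_le fun K => iSup_le fun hKU => iSup_le fun hK => ?_
  -- Intersecting with a thickening of $K$ keeps the support bounded.
  obtain ⟨g, gsm, grange, gsupp, gone⟩ := exists_contMDiff_support_eq_eq_one_iff
    (modelWithCornersSelf ℝ V) (n := ⊤) (hU.inter (Metric.isOpen_thickening (δ := 1) (E := K)))
    hK.isClosed (subset_inter hKU (Metric.self_subset_thickening one_pos K))
  have g0 : ∀ x, 0 ≤ g x := fun x => (grange (mem_range_self x)).1
  have g1 : ∀ x, g x ≤ 1 := fun x => (grange (mem_range_self x)).2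
  have gsm' : ContDiff ℝ ∞ g := gsm.contDiff
  have gc : HasCompactSupport g := by
    refine HasCompactSupport.of_support_subset_isCompact
      (hK.isBounded.cthickening (δ := 1)).isCompact_closure ?_
    rw [gsupp]
    exact inter_subset_right.trans
      ((Metric.thickening_subset_cthickening 1 K).trans subset_closure)
  have i1 : Integrable g ν := gsm'.continuous.integrable_of_hasCompactSupport gc
  have i2 : Integrable g ρ := gsm'.continuous.integrable_of_hasCompactSupport gc
  calc ν K = ∫⁻ x in K, 1 ∂ν := by simp
    _ ≤ ∫⁻ x in K, ENNReal.ofReal (g x) ∂ν := by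
        refine setLIntegral_mono' hK.measurableSet fun x hx => ?_
        rw [(gone x).1 hx]; simp
    _ ≤ ∫⁻ x, ENNReal.ofReal (g x) ∂ν := setLIntegral_le_lintegral _ _
    _ = ENNReal.ofReal (∫ x, g x ∂ν) :=
        (ofReal_integral_eq_lintegral_ofReal i1 (ae_of_all _ g0)).symm
    _ ≤ ENNReal.ofReal (∫ x, g x ∂ρ) := ENNReal.ofReal_le_ofReal (h g gsm' gc g0)
    _ = ∫⁻ x, ENNReal.ofReal (g x) ∂ρ :=
        ofReal_integral_eq_lintegral_ofReal i2 (ae_of_all _ g0)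
    _ ≤ ∫⁻ x, U.indicator 1 x ∂ρ := by
        refine lintegral_mono fun x => ?_
        by_cases hx : x ∈ U
        · simpa [hx] using g1 x
        · have : g x = 0 := by
            by_contra hne
            have : x ∈ Function.support g := hne
            rw [gsupp] at this
            exact hx this.1
          simp [this]
    _ = ρ U := lintegral_indicator_one hU.measurableSet

lemma measure_ext_of_integral_contDiff {ν ρ : Measure V}
    [IsLocallyFiniteMeasure ν] [IsLocallyFiniteMeasure ρ]
    (h : ∀ g : V → ℝ, ContDiff ℝ ∞ g → HasCompactSupport g → (∀ x, 0 ≤ g x) →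
      ∫ x, g x ∂ν = ∫ x, g x ∂ρ) : ν = ρ :=
  Measure.OuterRegular.ext_isOpen fun _ hU => le_antisymm
    (measure_isOpen_le_of_integral_contDiff_le (fun g a b c => (h g a b c).le) hU)
    (measure_isOpen_le_of_integral_contDiff_le (fun g a b c => (h g a b c).ge) hU)

/-- The multiplication formula is used twice: between $\nu$ and Lebesgue measure for $\mathcal
F^{-1}h$, then on Lebesgue measure for $h$. The factor $2\pi$ reconciles the conventions of
`charFun` and `𝓕`. -/
lemma integral_schwartz_eq_integral_fourier_charFun (ν : Measure V) [IsFiniteMeasure ν]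
    (hν : Integrable (charFun ν)) (h : 𝓢(V, ℂ)) :
    ∫ x, h x ∂ν = ∫ x, h x * 𝓕 (fun ξ : V => charFun ν ((2 * Real.pi) • ξ)) x := by
  have hG : Integrable (fun ξ : V => charFun ν ((2 * Real.pi) • ξ)) :=
    hν.comp_smul (by positivity)
  have hcont : Continuous fun p : V × V => (innerₗ V p.1) p.2 := by
    simpa using continuous_inner
  have key : ∀ x : V, VectorFourier.fourierIntegral Real.fourierChar ν (innerₗ V).flip
      (1 : V → ℂ) x = charFun ν ((2 * Real.pi) • (-x)) := by
    intro x
    rw [charFun_eq_fourierIntegral']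
    have : -(2 * Real.pi)⁻¹ • (2 * Real.pi) • -x = x := by
      rw [smul_smul, neg_mul, inv_mul_cancel₀ (by positivity)]; simp
    rw [this, flip_innerₗ]
  calc ∫ x, h x ∂ν = ∫ x, 𝓕 (𝓕⁻ h : 𝓢(V, ℂ)) x • (1 : V → ℂ) x ∂ν := by simp
    _ = ∫ x, (𝓕⁻ h : 𝓢(V, ℂ)) x • charFun ν ((2 * Real.pi) • (-x)) := by
        simp_rw [← key]
        rw [← VectorFourier.integral_fourierIntegral_smul_eq_flip Real.continuous_fourierChar hcont
          (𝓕⁻ h : 𝓢(V, ℂ)).integrable (g := (1 : V → ℂ)) (integrable_const (1 : ℂ))]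
        rfl
    _ = ∫ x, (𝓕 (h : V → ℂ)) (-x) • charFun ν ((2 * Real.pi) • (-x)) := by
        simp_rw [SchwartzMap.fourierInv_coe, Real.fourierInv_eq_fourier_neg]
    _ = ∫ x, (𝓕 (h : V → ℂ)) x • charFun ν ((2 * Real.pi) • x) :=
        integral_neg_eq_self
          (fun x => (𝓕 (h : V → ℂ)) x • charFun ν ((2 * Real.pi) • x)) volume
    _ = _ := by
        have := VectorFourier.integral_fourierIntegral_smul_eq_flip (L := innerₗ V)
          Real.continuous_fourierChar hcont (h.integrable (μ := volume)) hG
        rw [flip_innerₗ] at this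
        simpa only [smul_eq_mul] using! this

/-- A finite measure with integrable characteristic function has a continuous density, bounded by
the Fourier inversion formula. -/
theorem exists_density_of_integrable_charFun (ν : Measure V) [IsFiniteMeasure ν]
    (hν : Integrable (charFun ν)) :
    ∃ p : V → ℝ, Continuous p ∧ (∀ x, 0 ≤ p x) ∧
      ν = volume.withDensity (fun x => ENNReal.ofReal (p x)) ∧
      ∀ x, p x ≤ ∫ ξ : V, ‖charFun ν ((2 * Real.pi) • ξ)‖ := by
  have hG : Integrable (fun ξ : V => charFun ν ((2 * Real.pi) • ξ)) :=
    hν.comp_smul (by positivity)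
  -- `charFun` carries the sign $e^{+i\langle x,\xi\rangle}$, so the forward transform inverts it.
  set q : V → ℂ := 𝓕 (fun ξ : V => charFun ν ((2 * Real.pi) • ξ)) with hq
  have hqc : Continuous q :=
    VectorFourier.fourierIntegral_continuous Real.continuous_fourierChar
      (by simpa using continuous_inner) hG
  have hpc : Continuous (fun x => (q x).re) := Complex.continuous_re.comp hqc
  have htest : ∀ g : V → ℝ, ContDiff ℝ ∞ g → HasCompactSupport g →
      ∫ x, g x ∂ν = ∫ x, g x * (q x).re := by
    intro g gs gc
    have gc' : HasCompactSupport (fun x => (g x : ℂ)) := gc.comp_left (g := Complex.ofReal) rfl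
    have gs' : ContDiff ℝ ∞ (fun x => (g x : ℂ)) := Complex.ofRealCLM.contDiff.comp gs
    have := integral_schwartz_eq_integral_fourier_charFun ν hν (gc'.toSchwartzMap gs')
    change ∫ x, (g x : ℂ) ∂ν = ∫ x, (g x : ℂ) * q x at this
    have hint : Integrable (fun x => (g x : ℂ) * q x) :=
      (gs'.continuous.mul hqc).integrable_of_hasCompactSupport gc'.mul_right
    have h2 := congrArg Complex.re this
    rw [integral_complex_ofReal, Complex.ofReal_re] at h2
    rw [h2]
    refine (integral_re hint).symm.trans ?_
    simp
  have hp0 : ∀ x, 0 ≤ (q x).re := by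
    intro x
    by_contra! hx
    -- A bump supported where $\operatorname{Re} q<0$ would have negative $\nu$-integral.
    obtain ⟨g, gsupp, gc, gs, gr, g1⟩ := exists_contDiff_tsupport_subset (n := ⊤)
      ((isOpen_lt hpc continuous_const).mem_nhds hx)
    have g0 : ∀ x, 0 ≤ g x := fun x => (gr (mem_range_self x)).1
    have h1 : 0 < ∫ y, g y * -(q y).re := by
      refine Continuous.integral_pos_of_hasCompactSupport_nonneg_nonzero
        (x := x) (gs.continuous.mul hpc.neg) gc.mul_right ?_ ?_
      · intro y
        by_cases hy : y ∈ tsupport g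
        · exact mul_nonneg (g0 y) (neg_nonneg.2 (gsupp hy).le)
        · simp [image_eq_zero_of_notMem_tsupport hy]
      · simp only [g1, one_mul]
        linarith
    have h2 := htest g gs gc
    simp only [mul_neg, integral_neg] at h1
    have h3 : 0 ≤ ∫ x, g x ∂ν := integral_nonneg g0
    linarith
  have hlf : IsLocallyFiniteMeasure
      ((volume : Measure V).withDensity (fun x => ENNReal.ofReal (q x).re)) :=
    IsLocallyFiniteMeasure.withDensity_ofReal hpc
  refine ⟨fun x => (q x).re, hpc, hp0, ?_, ?_⟩
  · refine measure_ext_of_integral_contDiff fun g gs gc _ => ?_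
    rw [htest g gs gc, integral_withDensity_eq_integral_toReal_smul
      hpc.measurable.ennreal_ofReal (ae_of_all _ fun _ => ENNReal.ofReal_lt_top)]
    refine integral_congr_ae (ae_of_all _ fun x => ?_)
    simp [ENNReal.toReal_ofReal (hp0 x), mul_comm]
  · intro x
    exact (Complex.re_le_norm _).trans
      (VectorFourier.norm_fourierIntegral_le_integral_norm _ _ _ _ _)

end DensityOfCharFun

/-! ### Monotonicity, continuity and growth of Bernstein functions. -/

section Bernstein

lemma one_sub_exp_neg_mul_le {s t : ℝ} (hs : 0 ≤ s) :
    1 - Real.exp (-(s * t)) ≤ max 1 t * min 1 s := by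
  have h1 : 1 - Real.exp (-(s * t)) ≤ 1 := by linarith [Real.exp_pos (-(s * t))]
  have h2 : 1 - Real.exp (-(s * t)) ≤ s * t := by linarith [Real.add_one_le_exp (-(s * t))]
  rcases le_total 1 s with h | h
  · rw [min_eq_left h, mul_one]
    exact h1.trans (le_max_left _ _)
  · rw [min_eq_right h]
    refine h2.trans ?_
    rw [mul_comm]
    exact mul_le_mul_of_nonneg_right (le_max_right _ _) hs

lemma one_sub_exp_neg_mul_nonneg {s t : ℝ} (hs : 0 ≤ s) (ht : 0 ≤ t) :
    0 ≤ 1 - Real.exp (-(s * t)) :=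
  sub_nonneg.2 (Real.exp_le_one_iff.2 (neg_nonpos.2 (mul_nonneg hs ht)))

namespace IsBernsteinWith

variable {f : ℝ → ℝ} {a b : ℝ} {μ : Measure ℝ}

lemma ae_pos (h : IsBernsteinWith f a b μ) : ∀ᵐ s ∂μ, 0 < s := by
  have hc := measure_eq_zero_iff_ae_notMem.1 h.concentrated
  filter_upwards [hc] with s hs using not_le.1 hs

lemma integrable_min (h : IsBernsteinWith f a b μ) : Integrable (fun s : ℝ => min 1 s) μ := by
  refine ⟨by fun_prop, ?_⟩
  rw [hasFiniteIntegral_iff_ofReal]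
  · exact h.integrability
  · filter_upwards [h.ae_pos] with s hs using le_min zero_le_one hs.le

lemma integrable_one_sub_exp (h : IsBernsteinWith f a b μ) {t : ℝ} (ht : 0 ≤ t) :
    Integrable (fun s => 1 - Real.exp (-(s * t))) μ := by
  refine (h.integrable_min.const_mul (max 1 t)).mono' (by fun_prop) ?_
  filter_upwards [h.ae_pos] with s hs
  rw [Real.norm_of_nonneg (one_sub_exp_neg_mul_nonneg hs.le ht)]
  exact one_sub_exp_neg_mul_le hs.le

lemma apply_zero (h : IsBernsteinWith f a b μ) : f 0 = a := by
  simpa using h.repr 0 le_rfl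

lemma apply_nonneg (h : IsBernsteinWith f a b μ) {t : ℝ} (ht : 0 ≤ t) : 0 ≤ f t := by
  rw [h.repr t ht]
  refine add_nonneg (add_nonneg h.killing_nonneg (mul_nonneg h.drift_nonneg ht)) ?_
  refine integral_nonneg_of_ae ?_
  filter_upwards [h.ae_pos] with s hs using one_sub_exp_neg_mul_nonneg hs.le ht

lemma strictMonoOn (h : IsBernsteinWith f a b μ) (hμ : μ ≠ 0) : StrictMonoOn f (Ici 0) := by
  intro u hu v hv huv
  have hu : 0 ≤ u := hu
  have hv : 0 ≤ v := hv
  rw [h.repr u hu, h.repr v hv]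
  refine add_lt_add_of_le_of_lt
    (add_le_add_right (mul_le_mul_of_nonneg_left huv.le h.drift_nonneg) _) ?_
  have hlt : ∀ᵐ s ∂μ, 1 - Real.exp (-(s * u)) < 1 - Real.exp (-(s * v)) := by
    filter_upwards [h.ae_pos] with s hs
    have : s * u < s * v := mul_lt_mul_of_pos_left huv hs
    have := Real.exp_lt_exp.2 (neg_lt_neg this)
    linarith
  refine sub_pos.1 ?_
  rw [← integral_sub (h.integrable_one_sub_exp hv) (h.integrable_one_sub_exp hu),
    integral_pos_iff_support_of_nonneg_ae (hlt.mono fun s hs => (sub_pos.2 hs).le)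
      ((h.integrable_one_sub_exp hv).sub (h.integrable_one_sub_exp hu)), pos_iff_ne_zero]
  intro h0
  have hempty : ∀ᵐ s ∂μ, False := by
    filter_upwards [hlt, measure_eq_zero_iff_ae_notMem.1 h0] with s h1 h2
    exact h2 (sub_pos.2 h1).ne'
  exact hμ (ae_eq_bot.1 (by simpa using hempty))

lemma continuousOn (h : IsBernsteinWith f a b μ) : ContinuousOn f (Ici 0) := by
  have hI : ContinuousOn (fun t => ∫ s, (1 - Real.exp (-(s * t))) ∂μ) (Ici 0) := by
    intro t ht
    refine continuousWithinAt_of_dominated (bound := fun s => max 1 (t + 1) * min 1 s)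
      (Eventually.of_forall fun u => by fun_prop) ?_ (h.integrable_min.const_mul _)
      (ae_of_all _ fun s => by fun_prop)
    have h1 : ∀ᶠ u in 𝓝[Ici 0] t, u ≤ t + 1 :=
      mem_nhdsWithin_of_mem_nhds (Iic_mem_nhds (by linarith))
    filter_upwards [h1, self_mem_nhdsWithin] with u hu hu0
    filter_upwards [h.ae_pos] with s hs
    rw [Real.norm_of_nonneg (one_sub_exp_neg_mul_nonneg hs.le hu0)]
    refine (one_sub_exp_neg_mul_le hs.le).trans ?_
    exact mul_le_mul_of_nonneg_right (max_le_max le_rfl hu) (le_min zero_le_one hs.le)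
  refine ContinuousOn.congr (f := fun t => a + b * t + ∫ s, (1 - Real.exp (-(s * t))) ∂μ)
    (ContinuousOn.add (by fun_prop) hI) fun t ht => h.repr t ht

/-- With $\mu=0$, $f$ is a constant $a>0$, and $a\,t^{-\kappa}$ strictly decreases. -/
lemma measure_ne_zero_of_monotoneOn (h : IsBernsteinWith f a 0 μ)
    (hf0 : ∃ t : ℝ, 0 ≤ t ∧ f t ≠ 0) {κ T : ℝ} (hκ : 0 < κ) (hT : 0 < T)
    (hm : MonotoneOn (fun t : ℝ => f t * t ^ (-κ)) (Ici T)) : μ ≠ 0 := by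
  rintro rfl
  have hc : ∀ t, 0 ≤ t → f t = a := fun t ht => by simpa using h.repr t ht
  obtain ⟨t, ht, hne⟩ := hf0
  rw [hc t ht] at hne
  have ha : 0 < a := lt_of_le_of_ne h.killing_nonneg hne.symm
  have h1 := hm (a := T) (b := T + 1) self_mem_Ici (mem_Ici.2 (by linarith)) (by linarith)
  simp only [hc T hT.le, hc (T + 1) (by linarith)] at h1
  have h2 : (T + 1) ^ (-κ) < T ^ (-κ) :=
    Real.rpow_lt_rpow_of_neg hT (by linarith) (by linarith)
  nlinarith

end IsBernsteinWith

lemma rpow_div_mul_le_of_monotoneOn {f : ℝ → ℝ} {κ T : ℝ} (hT : 0 < T)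
    (hm : MonotoneOn (fun t : ℝ => f t * t ^ (-κ)) (Ici T)) {r t : ℝ} (hr : T ≤ r) (hrt : r ≤ t) :
    (t / r) ^ κ * f r ≤ f t := by
  have hr0 : 0 < r := hT.trans_le hr
  have ht0 : 0 < t := hr0.trans_le hrt
  have h1 : f r * r ^ (-κ) ≤ f t * t ^ (-κ) := hm hr (hr.trans hrt) hrt
  have h2 := mul_le_mul_of_nonneg_right h1 (Real.rpow_nonneg ht0.le κ)
  rw [mul_assoc (f t), ← Real.rpow_add ht0, neg_add_cancel, Real.rpow_zero, mul_one] at h2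
  refine le_trans (le_of_eq ?_) h2
  rw [Real.div_rpow ht0.le hr0.le, Real.rpow_neg hr0.le]
  ring

lemma bijOn_Ici_of_strictMonoOn_of_continuousOn {f : ℝ → ℝ} {κ T : ℝ} (hκ : 0 < κ) (hT : 0 < T)
    (hm : MonotoneOn (fun t : ℝ => f t * t ^ (-κ)) (Ici T))
    (hs : StrictMonoOn f (Ici 0)) (hc : ContinuousOn f (Ici 0)) (h0 : 0 ≤ f 0) :
    BijOn f (Ici 0) (Ici (f 0)) := by
  refine ⟨fun t ht => hs.monotoneOn self_mem_Ici ht ht, hs.injOn, fun y hy => ?_⟩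
  have hfT : 0 < f T := h0.trans_lt (hs self_mem_Ici hT.le hT)
  have hlim : Tendsto (fun t : ℝ => (t / T) ^ κ * f T) atTop atTop :=
    ((tendsto_rpow_atTop hκ).comp (tendsto_id.atTop_div_const hT)).atTop_mul_const hfT
  obtain ⟨t, hty, htT⟩ := ((hlim.eventually_ge_atTop y).and (eventually_ge_atTop T)).exists
  have hft : y ≤ f t := hty.trans (rpow_div_mul_le_of_monotoneOn hT hm le_rfl htT)
  have ht0 : 0 ≤ t := hT.le.trans htT
  obtain ⟨s, hs1, hs2⟩ := intermediate_value_Icc ht0 (hc.mono Icc_subset_Ici_self) ⟨hy, hft⟩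
  exact ⟨s, hs1.1, hs2⟩

end Bernstein

/-! ### Lower bound for $\psi_1$. -/

section Exponent

lemma psiOneIntegrand_nonneg {n : ℕ} {f : ℝ → ℝ} (hf : ∀ t, 0 ≤ t → 0 ≤ f t)
    (ξ y : EuclideanSpace ℝ (Fin n)) : 0 ≤ psiOneIntegrand n f ξ y :=
  div_nonneg (mul_nonneg (sub_nonneg.2 (Real.cos_le_one _)) (hf _ (by positivity))) (by positivity)

/-- A ball of radius comparable to $1/|\xi|$ suffices: on it $\xi\cdot y\in[1/2,1]$ and
$|y|<1/|\xi|$, so the integrand is at least a constant times $f(|\xi|^2)|\xi|^n$, and the volume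
cancels $|\xi|^n$. -/
lemma exists_mul_le_psiOne {n : ℕ} {f : ℝ → ℝ} (hf : ∀ t, 0 ≤ t → 0 ≤ f t)
    (hmono : MonotoneOn f (Ici 0)) (hfin : PsiOneFinite n f) :
    ∃ c : ℝ, 0 < c ∧ ∀ ξ : EuclideanSpace ℝ (Fin n), 1 ≤ ‖ξ‖ → c * f (‖ξ‖ ^ 2) ≤ psiOne n f ξ := by
  set v : ℝ := volume.real (Metric.ball (0 : EuclideanSpace ℝ (Fin n)) 1) with hv
  have hv0 : 0 < v :=
    ENNReal.toReal_pos (Metric.measure_ball_pos _ _ one_pos).ne' measure_ball_lt_top.ne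
  have hcos : 0 < 1 - Real.cos (1 / 2) := by
    have := Real.cos_lt_cos_of_nonneg_of_le_pi (x := 0) (y := 1 / 2) le_rfl
      (by linarith [Real.pi_gt_three]) (by norm_num)
    rw [Real.cos_zero] at this
    linarith
  refine ⟨(1 - Real.cos (1 / 2)) * ((1 / 4) ^ n * v), by positivity, fun ξ hξ => ?_⟩
  have hξ0 : 0 < ‖ξ‖ := one_pos.trans_le hξ
  -- The center has $\xi\cdot z=3/4$; radius $1/(4|\xi|)$ moves this by at most $1/4$.
  set z : EuclideanSpace ℝ (Fin n) := (3 / (4 * ‖ξ‖ ^ 2)) • ξ with hz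
  have hzn : ‖z‖ = 3 / (4 * ‖ξ‖) := by
    rw [hz, norm_smul, Real.norm_of_nonneg (by positivity)]
    field_simp
  have hzi : ⟪ξ, z⟫ = 3 / 4 := by
    rw [hz, inner_smul_right, real_inner_self_eq_norm_sq]
    field_simp
  set B := Metric.ball z (1 / (4 * ‖ξ‖)) with hB
  have hyn : ∀ y ∈ B, ‖y‖ < 1 / ‖ξ‖ := by
    intro y hy
    rw [hB, mem_ball_iff_norm] at hy
    have h1 : ‖y‖ ≤ ‖y - z‖ + ‖z‖ := by simpa using norm_add_le (y - z) z
    have h2 : 1 / (4 * ‖ξ‖) + 3 / (4 * ‖ξ‖) = 1 / ‖ξ‖ := by field_simp; norm_num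
    linarith
  have hyi : ∀ y ∈ B, 1 / 2 ≤ ⟪ξ, y⟫ ∧ ⟪ξ, y⟫ ≤ 1 := by
    intro y hy
    rw [hB, mem_ball_iff_norm] at hy
    have h1 : |⟪ξ, y - z⟫| ≤ 1 / 4 := by
      refine (abs_real_inner_le_norm ξ (y - z)).trans ?_
      calc ‖ξ‖ * ‖y - z‖ ≤ ‖ξ‖ * (1 / (4 * ‖ξ‖)) := by gcongr
        _ = 1 / 4 := by field_simp
    rw [inner_sub_right, hzi] at h1
    have := abs_le.1 h1
    constructor <;> linarith [this.1, this.2]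
  have hsub : B ⊆ Metric.ball 0 1 := by
    intro y hy
    rw [mem_ball_zero_iff]
    refine (hyn y hy).trans_le ?_
    rw [div_le_one hξ0]
    exact hξ
  have hvolB : volume.real B = (1 / (4 * ‖ξ‖)) ^ n * v := by
    rw [hB, Measure.real, Measure.addHaar_ball_of_pos _ _ (by positivity), ENNReal.toReal_mul,
      ENNReal.toReal_ofReal (by positivity), finrank_euclideanSpace_fin]
    rfl
  have hlow : ∀ y ∈ B, (1 - Real.cos (1 / 2)) * f (‖ξ‖ ^ 2) * ‖ξ‖ ^ n ≤
      psiOneIntegrand n f ξ y := by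
    intro y hy
    have hy0 : 0 < ‖y‖ := by
      rw [norm_pos_iff]
      rintro rfl
      have := (hyi 0 hy).1
      norm_num at this
    have hle : ‖ξ‖ ≤ 1 / ‖y‖ := ((lt_one_div hξ0 hy0).2 (hyn y hy)).le
    have h1 : 1 - Real.cos (1 / 2) ≤ 1 - Real.cos ⟪ξ, y⟫ := by
      have := Real.cos_le_cos_of_nonneg_of_le_pi (x := 1 / 2) (y := ⟪ξ, y⟫) (by norm_num)
        (by linarith [(hyi y hy).2, Real.pi_gt_three]) (hyi y hy).1
      linarith
    have h2 : f (‖ξ‖ ^ 2) ≤ f (1 / ‖y‖ ^ 2) := by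
      refine hmono (mem_Ici.2 (by positivity)) (mem_Ici.2 (by positivity)) ?_
      rw [← one_div_pow]
      gcongr
    have h3 : ‖ξ‖ ^ n ≤ (1 / ‖y‖) ^ n := by gcongr
    have h4 : psiOneIntegrand n f ξ y =
        (1 - Real.cos ⟪ξ, y⟫) * f (1 / ‖y‖ ^ 2) * (1 / ‖y‖) ^ n := by
      rw [psiOneIntegrand, one_div_pow (‖y‖) n]
      ring
    rw [h4]
    have := hf (‖ξ‖ ^ 2) (by positivity)
    have := hf (1 / ‖y‖ ^ 2) (by positivity)
    have := hcos.le.trans h1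
    gcongr
  calc (1 - Real.cos (1 / 2)) * ((1 / 4) ^ n * v) * f (‖ξ‖ ^ 2)
      = volume.real B • ((1 - Real.cos (1 / 2)) * f (‖ξ‖ ^ 2) * ‖ξ‖ ^ n) := by
        have : (1 / (4 * ‖ξ‖)) ^ n * ‖ξ‖ ^ n = (1 / 4) ^ n := by
          rw [← mul_pow]
          congr 1
          field_simp
        rw [hvolB, smul_eq_mul, ← this]
        ring
    _ = ∫ _ in B, (1 - Real.cos (1 / 2)) * f (‖ξ‖ ^ 2) * ‖ξ‖ ^ n := by
        rw [setIntegral_const]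
    _ ≤ ∫ y in B, psiOneIntegrand n f ξ y := by
        refine setIntegral_mono_on ?_ ((hfin ξ).mono_set hsub) measurableSet_ball hlow
        exact integrableOn_const measure_ball_lt_top.ne
    _ ≤ psiOne n f ξ :=
        setIntegral_mono_set (hfin ξ) (ae_of_all _ fun y => psiOneIntegrand_nonneg hf ξ y)
          hsub.eventuallyLE

end Exponent

/-! ### Integrability of $e^{-|x|^{2\kappa}}$. -/

section StretchedExponential

/-- Polar coordinates reduce this to $r^{d-1}e^{-r^{2\kappa}}$ on $(0,\infty)$. -/
lemma integrable_exp_neg_norm_sq_rpow {V : Type*} [NormedAddCommGroup V] [NormedSpace ℝ V]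
    [FiniteDimensional ℝ V] [Nontrivial V] [MeasurableSpace V] [BorelSpace V] (μ : Measure V)
    [μ.IsAddHaarMeasure] {κ : ℝ} (hκ : 0 < κ) :
    Integrable (fun x : V => Real.exp (-(‖x‖ ^ 2) ^ κ)) μ := by
  refine (integrable_fun_norm_addHaar μ (f := fun r : ℝ => Real.exp (-(r ^ 2) ^ κ))).2 ?_
  have hd : 0 < Module.finrank ℝ V := Module.finrank_pos
  refine (integrableOn_rpow_mul_exp_neg_rpow (p := 2 * κ)
    (s := ((Module.finrank ℝ V - 1 : ℕ) : ℝ))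
    (lt_of_lt_of_le (by norm_num) (Nat.cast_nonneg _)) (by positivity)).congr_fun
    (fun r hr => ?_) measurableSet_Ioi
  have hr : 0 < r := hr
  simp only [smul_eq_mul]
  rw [Real.rpow_natCast, Real.rpow_mul hr.le]
  norm_num

end StretchedExponential

/-! ### From exponent bounds to density bounds. -/

section TransitionDensity

lemma norm_charFun_of_hasExponent {n : ℕ} {Ω : Type*} [MeasurableSpace Ω] {P : Measure Ω}
    {X : ℝ≥0 → Ω → EuclideanSpace ℝ (Fin n)} {ψ : EuclideanSpace ℝ (Fin n) → ℝ}
    (hX : HasExponent X P ψ) (t : ℝ≥0) (ξ : EuclideanSpace ℝ (Fin n)) :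
    ‖charFun (P.map (X t)) ξ‖ = Real.exp (-((t : ℝ) * ψ ξ)) := by
  rw [hX t ξ, Complex.norm_real, Real.norm_of_nonneg (Real.exp_pos _).le]

lemma exponent_nonneg_of_hasExponent {n : ℕ} {Ω : Type*} [MeasurableSpace Ω] {P : Measure Ω}
    [IsProbabilityMeasure P] {X : ℝ≥0 → Ω → EuclideanSpace ℝ (Fin n)}
    {ψ : EuclideanSpace ℝ (Fin n) → ℝ} (hm : ∀ t, Measurable (X t))
    (hX : HasExponent X P ψ) (ξ : EuclideanSpace ℝ (Fin n)) : 0 ≤ ψ ξ := by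
  have : IsProbabilityMeasure (P.map (X 1)) :=
    Measure.isProbabilityMeasure_map (hm 1).aemeasurable
  have h1 := norm_charFun_le_one (μ := P.map (X 1)) (t := ξ)
  rw [norm_charFun_of_hasExponent hX, Real.exp_le_one_iff] at h1
  simpa using h1

/-- A lower bound by a power of the rescaled squared norm at high frequencies gives
a stretched exponential bound valid at all frequencies. -/
lemma exp_neg_le_of_rpow_le {κ u R y : ℝ} (hκ : 0 < κ) (hR : 0 < R) (hu : 0 ≤ u) (hy : 0 ≤ y)
    (h : R ≤ u → (u / R) ^ κ ≤ y) : Real.exp (-y) ≤ Real.exp 1 * Real.exp (-(u / R) ^ κ) := by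
  rw [← Real.exp_add]
  refine Real.exp_le_exp.2 ?_
  rcases le_total R u with hRu | hRu
  · linarith [h hRu]
  · have := Real.rpow_le_one (div_nonneg hu hR.le) ((div_le_one hR).2 hRu) hκ.le
    linarith

variable {n : ℕ}

lemma norm_sq_div_eq_norm_smul_sq {R : ℝ} (hR : 0 < R) (ξ : EuclideanSpace ℝ (Fin n)) :
    ‖ξ‖ ^ 2 / R = ‖(√R)⁻¹ • ξ‖ ^ 2 := by
  rw [norm_smul, mul_pow, Real.norm_of_nonneg (by positivity), inv_pow, Real.sq_sqrt hR.le]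
  ring

lemma integrable_exp_neg_norm_sq_div_rpow [Nontrivial (EuclideanSpace ℝ (Fin n))] {κ R : ℝ}
    (hκ : 0 < κ) (hR : 0 < R) :
    Integrable (fun ξ : EuclideanSpace ℝ (Fin n) => Real.exp (-(‖ξ‖ ^ 2 / R) ^ κ)) := by
  simp_rw [norm_sq_div_eq_norm_smul_sq hR]
  exact (integrable_exp_neg_norm_sq_rpow volume hκ).comp_smul (by positivity)

lemma integral_exp_neg_norm_sq_div_rpow {κ R : ℝ} (hR : 0 < R) :
    ∫ ξ : EuclideanSpace ℝ (Fin n), Real.exp (-(‖ξ‖ ^ 2 / R) ^ κ) =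
      R ^ ((n : ℝ) / 2) * ∫ ξ : EuclideanSpace ℝ (Fin n), Real.exp (-(‖ξ‖ ^ 2) ^ κ) := by
  simp_rw [norm_sq_div_eq_norm_smul_sq hR]
  rw [Measure.integral_comp_inv_smul volume
    (fun ξ : EuclideanSpace ℝ (Fin n) => Real.exp (-(‖ξ‖ ^ 2) ^ κ)), finrank_euclideanSpace_fin,
    smul_eq_mul, abs_of_nonneg (by positivity), Real.sqrt_eq_rpow, ← Real.rpow_natCast,
    ← Real.rpow_mul hR.le]
  congr 2
  ring

lemma exists_density_le_of_norm_charFun_le [Nontrivial (EuclideanSpace ℝ (Fin n))]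
    (ν : Measure (EuclideanSpace ℝ (Fin n))) [IsFiniteMeasure ν] {κ R : ℝ} (hκ : 0 < κ)
    (hR : 0 < R) (h : ∀ ξ, ‖charFun ν ξ‖ ≤ Real.exp 1 * Real.exp (-(‖ξ‖ ^ 2 / R) ^ κ)) :
    ∃ p : EuclideanSpace ℝ (Fin n) → ℝ, Measurable p ∧ (∀ x, 0 ≤ p x) ∧
      ν = volume.withDensity (fun x => ENNReal.ofReal (p x)) ∧
      ∀ x, p x ≤ (Real.exp 1 * ∫ ξ : EuclideanSpace ℝ (Fin n), Real.exp (-(‖ξ‖ ^ 2) ^ κ)) *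
        R ^ ((n : ℝ) / 2) := by
  have hi := (integrable_exp_neg_norm_sq_div_rpow (n := n) hκ hR).const_mul (Real.exp 1)
  have hν : Integrable (charFun ν) :=
    hi.mono' measurable_charFun.aestronglyMeasurable (ae_of_all _ h)
  obtain ⟨p, pc, p0, pd, pb⟩ := exists_density_of_integrable_charFun ν hν
  refine ⟨p, pc.measurable, p0, pd, fun x => (pb x).trans ?_⟩
  calc ∫ ξ : EuclideanSpace ℝ (Fin n), ‖charFun ν ((2 * Real.pi) • ξ)‖
      ≤ ∫ ξ : EuclideanSpace ℝ (Fin n), Real.exp 1 * Real.exp (-(‖ξ‖ ^ 2 / R) ^ κ) := by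
        refine integral_mono (hν.comp_smul (by positivity)).norm hi fun ξ => (h _).trans ?_
        -- The bound decreases in $|\xi|$, so the dilation by $2\pi>1$ can be dropped.
        have : ‖ξ‖ ≤ ‖(2 * Real.pi) • ξ‖ := by
          rw [norm_smul, Real.norm_of_nonneg (by positivity)]
          exact le_mul_of_one_le_left (norm_nonneg _) (by linarith [Real.pi_gt_three])
        gcongr
    _ = _ := by
        rw [integral_const_mul, integral_exp_neg_norm_sq_div_rpow hR]
        ring

lemma exists_transitionDensity_le [Nontrivial (EuclideanSpace ℝ (Fin n))]
    {Ω : Type*} [MeasurableSpace Ω] {P : Measure Ω} [IsProbabilityMeasure P]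
    {X : ℝ≥0 → Ω → EuclideanSpace ℝ (Fin n)} {ψ : EuclideanSpace ℝ (Fin n) → ℝ}
    (hm : ∀ t, Measurable (X t)) (hX : HasExponent X P ψ) {κ : ℝ} (hκ : 0 < κ) {R : ℝ≥0 → ℝ}
    (hR : ∀ t : ℝ≥0, 0 < t → t ≤ 1 → 0 < R t)
    (hψ : ∀ t : ℝ≥0, 0 < t → t ≤ 1 → ∀ ξ : EuclideanSpace ℝ (Fin n), R t ≤ ‖ξ‖ ^ 2 →
      (‖ξ‖ ^ 2 / R t) ^ κ ≤ t * ψ ξ) :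
    ∃ p : ℝ≥0 → EuclideanSpace ℝ (Fin n) → ℝ, IsTransitionDensity X P p ∧
      ∀ t : ℝ≥0, 0 < t → t ≤ 1 → ∀ x : EuclideanSpace ℝ (Fin n),
        p t x ≤ (Real.exp 1 * ∫ ξ : EuclideanSpace ℝ (Fin n), Real.exp (-(‖ξ‖ ^ 2) ^ κ)) *
          R t ^ ((n : ℝ) / 2) := by
  have hprob : ∀ t, IsProbabilityMeasure (P.map (X t)) := fun t =>
    Measure.isProbabilityMeasure_map (hm t).aemeasurable
  have hψ0 := exponent_nonneg_of_hasExponent hm hX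
  -- Since $\psi\ge 0$, $e^{-t\psi}$ decreases in $t$; taking $s=\min(t,1)$ gives a density also for
  -- $t>1$.
  have hchar : ∀ s t : ℝ≥0, 0 < s → s ≤ 1 → s ≤ t → ∀ ξ,
      ‖charFun (P.map (X t)) ξ‖ ≤ Real.exp 1 * Real.exp (-(‖ξ‖ ^ 2 / R s) ^ κ) := by
    intro s t hs hs1 hst ξ
    rw [norm_charFun_of_hasExponent hX]
    refine le_trans (Real.exp_le_exp.2 (neg_le_neg ?_))
      (exp_neg_le_of_rpow_le hκ (hR s hs hs1) (sq_nonneg _)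
        (mul_nonneg s.coe_nonneg (hψ0 ξ)) (hψ s hs hs1 ξ))
    exact mul_le_mul_of_nonneg_right (NNReal.coe_le_coe.2 hst) (hψ0 ξ)
  have hex : ∀ t : ℝ≥0, ∃ p : EuclideanSpace ℝ (Fin n) → ℝ, 0 < t →
      (Measurable p ∧ (∀ x, 0 ≤ p x) ∧
        P.map (X t) = volume.withDensity (fun x => ENNReal.ofReal (p x))) ∧
      (t ≤ 1 → ∀ x, p x ≤
        (Real.exp 1 * ∫ ξ : EuclideanSpace ℝ (Fin n), Real.exp (-(‖ξ‖ ^ 2) ^ κ)) *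
          R t ^ ((n : ℝ) / 2)) := by
    intro t
    rcases eq_or_lt_of_le (zero_le : 0 ≤ t) with rfl | ht
    · exact ⟨0, fun h => absurd h (lt_irrefl _)⟩
    have hs : 0 < min t 1 := lt_min ht one_pos
    obtain ⟨p, p1, p2, p3, p4⟩ := exists_density_le_of_norm_charFun_le (P.map (X t)) hκ
      (hR _ hs (min_le_right _ _)) (hchar (min t 1) t hs (min_le_right _ _) (min_le_left _ _))
    refine ⟨p, fun _ => ⟨⟨p1, p2, p3⟩, fun ht1 => ?_⟩⟩
    rwa [min_eq_left ht1] at p4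
  choose p hp using hex
  exact ⟨p, fun t ht => (hp t ht).1, fun t ht => (hp t ht).2⟩

end TransitionDensity

/-! ### Choice of constants and conclusion. -/

theorem lemma2p2 (n : ℕ) (hn : 1 ≤ n) (f : ℝ → ℝ)
    (hf : IsBernsteinNoLinear f)
    (hf0 : ∃ t : ℝ, 0 ≤ t ∧ f t ≠ 0)
    (hgrowth : ∃ κ ∈ Ioo (0 : ℝ) 1, ∃ T : ℝ, 0 < T ∧
      MonotoneOn (fun t : ℝ => f t * t ^ (-κ)) (Ici T)) :
    BijOn f (Ici 0) (Ici (f 0)) ∧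
    ∀ ψ : EuclideanSpace ℝ (Fin n) → ℝ,
      (ψ = (fun ξ => f (‖ξ‖ ^ 2)) ∨ (PsiOneFinite n f ∧ ψ = psiOne n f)) →
      ∃ c γ : ℝ, 0 < c ∧ 0 < γ ∧ γ ≤ 1 ∧
        (∀ t : ℝ≥0, 0 < t → t ≤ 1 → f 0 ≤ 1 / (γ * t)) ∧
        ∀ (Ω : Type*) [MeasurableSpace Ω] (P : Measure Ω) [IsProbabilityMeasure P]
          (X : ℝ≥0 → Ω → EuclideanSpace ℝ (Fin n)),
          IsLevyProcess X P → HasExponent X P ψ →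
          ∃ p : ℝ≥0 → EuclideanSpace ℝ (Fin n) → ℝ,
            IsTransitionDensity X P p ∧
            ∀ t : ℝ≥0, 0 < t → t ≤ 1 → ∀ x : EuclideanSpace ℝ (Fin n),
              p t x ≤ c * (invNonneg f (1 / (γ * t))) ^ ((n : ℝ) / 2) := by
  obtain ⟨a, μ, hB⟩ := hf
  obtain ⟨κ, ⟨hκ, -⟩, T, hT, hm⟩ := hgrowth
  have hs : StrictMonoOn f (Ici 0) :=
    hB.strictMonoOn (hB.measure_ne_zero_of_monotoneOn hf0 hκ hT hm)
  have hfnn : ∀ t, 0 ≤ t → 0 ≤ f t := fun t ht => hB.apply_nonneg ht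
  have hbij := bijOn_Ici_of_strictMonoOn_of_continuousOn hκ hT hm hs hB.continuousOn
    (hfnn 0 le_rfl)
  refine ⟨hbij, fun ψ hψ => ?_⟩
  obtain ⟨c₀, hc₀, hlow⟩ : ∃ c : ℝ, 0 < c ∧
      ∀ ξ : EuclideanSpace ℝ (Fin n), 1 ≤ ‖ξ‖ → c * f (‖ξ‖ ^ 2) ≤ ψ ξ := by
    rcases hψ with rfl | ⟨hfin, rfl⟩
    · exact ⟨1, one_pos, fun ξ _ => (one_mul _).le⟩
    · exact exists_mul_le_psiOne hfnn hs.monotoneOn hfin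
  have hT₁ : 0 < max 1 T := lt_max_of_lt_left one_pos
  have hfT₁ : f 0 < f (max 1 T) := hs self_mem_Ici hT₁.le hT₁
  have hfT₁' : 0 < f (max 1 T) := (hfnn 0 le_rfl).trans_lt hfT₁
  -- $\gamma\le c_0$ absorbs the constant of the lower bound; $\gamma\le 1/f(\max(1,T))$ forces
  -- $R\ge\max(1,T)$ for all $t\le 1$.
  obtain ⟨γ, hγ, hγ1, hγc, hγf⟩ :
      ∃ γ : ℝ, 0 < γ ∧ γ ≤ 1 ∧ γ ≤ c₀ ∧ γ ≤ 1 / f (max 1 T) :=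
    ⟨min 1 (min c₀ (1 / f (max 1 T))), by positivity, min_le_left _ _,
      (min_le_right _ _).trans (min_le_left _ _), (min_le_right _ _).trans (min_le_right _ _)⟩
  have hlevel : ∀ t : ℝ≥0, 0 < t → t ≤ 1 → f (max 1 T) ≤ 1 / (γ * t) := by
    intro t ht ht1
    have ht0 : (0 : ℝ) < t := ht
    have ht1' : (t : ℝ) ≤ 1 := ht1
    rw [le_one_div hfT₁' (by positivity)]
    exact (mul_le_of_le_one_right hγ.le ht1').trans hγf
  have hinv : ∀ t : ℝ≥0, 0 < t → t ≤ 1 → 0 ≤ invNonneg f (1 / (γ * t)) ∧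
      f (invNonneg f (1 / (γ * t))) = 1 / (γ * t) := fun t ht ht1 =>
    Function.invFunOn_pos (hbij.surjOn (hfT₁.le.trans (hlevel t ht ht1)))
  have hRT : ∀ t : ℝ≥0, 0 < t → t ≤ 1 → max 1 T ≤ invNonneg f (1 / (γ * t)) := by
    intro t ht ht1
    obtain ⟨h0, h1⟩ := hinv t ht ht1
    rw [← hs.le_iff_le hT₁.le h0, h1]
    exact hlevel t ht ht1
  have : Nonempty (Fin n) := ⟨⟨0, hn⟩⟩
  -- Adding $1$ makes $c>0$ from mere nonnegativity of the integral.
  refine ⟨Real.exp 1 * (∫ ξ : EuclideanSpace ℝ (Fin n), Real.exp (-(‖ξ‖ ^ 2) ^ κ)) + 1, γ,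
    by positivity, hγ, hγ1, fun t ht ht1 => hfT₁.le.trans (hlevel t ht ht1), ?_⟩
  intro Ω _ P _ X hL hX
  obtain ⟨p, hp, hpb⟩ := exists_transitionDensity_le hL.measurable hX hκ
    (R := fun t => invNonneg f (1 / (γ * t)))
    (fun t ht ht1 => hT₁.trans_le (hRT t ht ht1)) (by
      intro t ht ht1 ξ hξ
      have ht0 : (0 : ℝ) < t := ht
      have hR := hRT t ht ht1
      have hξ1 : 1 ≤ ‖ξ‖ :=
        (one_le_sq_iff₀ (norm_nonneg _)).1 ((le_max_left 1 T).trans (hR.trans hξ))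
      have hg := rpow_div_mul_le_of_monotoneOn hT hm ((le_max_right 1 T).trans hR) hξ
      rw [(hinv t ht ht1).2] at hg
      have hpow : 0 ≤ (‖ξ‖ ^ 2 / invNonneg f (1 / (γ * t))) ^ κ :=
        Real.rpow_nonneg (div_nonneg (sq_nonneg _) (hinv t ht ht1).1) _
      calc (‖ξ‖ ^ 2 / invNonneg f (1 / (γ * t))) ^ κ
          = t * (γ * ((‖ξ‖ ^ 2 / invNonneg f (1 / (γ * t))) ^ κ * (1 / (γ * t)))) := by
            field_simp
        _ ≤ t * (c₀ * f (‖ξ‖ ^ 2)) := by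
            have := hfnn (‖ξ‖ ^ 2) (sq_nonneg _)
            gcongr
        _ ≤ t * ψ ξ := by
            have := hlow ξ hξ1
            gcongr)
  refine ⟨p, hp, fun t ht ht1 x => (hpb t ht ht1 x).trans ?_⟩
  exact mul_le_mul_of_nonneg_right (by linarith)
    (Real.rpow_nonneg (hinv t ht ht1).1 _)
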